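/- Let $n \ge 1$ and $p, m \ge 0$ be integers, fix a matrix $D \in \mathbb{R}^{m \times p}$ and a real number $\lambda > 0$, and let $(X,y)$ be a random element of $\mathbb{R}^{n \times p} \times \mathbb{R}^n$ whose joint distribution is absolutely continuous with respect to $(np+n)$-dimensional Lebesgue measure. Let $\mathbb{1} \in \mathbb{R}^n$ be the vector of all ones and $M = I - \mathbb{1}\mathbb{1}^T/n \in \mathbb{R}^{n\times n}$ the centering matrix, and for $A \in \mathbb{R}^{n \times p}$ with columns $A_1,\dots,A_p$ let $W_A = \mathrm{diag}(\|A_1\|_2, \dots, \|A_p\|_2)$. Assume that either $p \le n-1$, or else $n \ge 3$ and $\mathrm{nullity}(D) = \dim \mathrm{null}(D) \le n-1$. Then, almost surely, the matrix $W_{MX}$ is invertible and the standardized generalized lasso problem $$ \mathop{\mathrm{minimize}}_{\beta \in \mathbb{R}^p} \; \frac12 \big\| y - M X W_{MX}^{-1} \beta \big\|_2^2 + \lambda \| D \beta \|_1 $$ has exactly one solution (global minimizer) $\beta$. -/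

import Mathlib

open MeasureTheory

noncomputable section

/-- The generalized lasso criterion
`(1/2) ‖y - A β‖₂² + lam ‖D β‖₁` with response `y` and predictor matrix `A`. -/
def genLassoCriterion {n p m : ℕ} (y : Fin n → ℝ) (A : Matrix (Fin n) (Fin p) ℝ)
    (D : Matrix (Fin m) (Fin p) ℝ) (lam : ℝ) (β : Fin p → ℝ) : ℝ :=
  (1 / 2) * ‖WithLp.toLp 2 (y - A.mulVec β)‖ ^ 2 + lam * ‖WithLp.toLp 1 (D.mulVec β)‖

/-- `β` is a solution of the generalized lasso problem: a global minimizer of its criterion. -/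
def IsGenLassoSolution {n p m : ℕ} (y : Fin n → ℝ) (A : Matrix (Fin n) (Fin p) ℝ)
    (D : Matrix (Fin m) (Fin p) ℝ) (lam : ℝ) (β : Fin p → ℝ) : Prop :=
  ∀ β' : Fin p → ℝ, genLassoCriterion y A D lam β ≤ genLassoCriterion y A D lam β'

/-- The centering map `M = I - 𝟙 𝟙ᵀ / n`. -/
def centeringMatrix (n : ℕ) : Matrix (Fin n) (Fin n) ℝ :=
  1 - (n : ℝ)⁻¹ • Matrix.vecMulVec (fun _ => 1) (fun _ => 1)

/-- `W_A = diag(‖A_1‖₂, …, ‖A_p‖₂)`, where `A_j` is the `j`-th column of `A`. -/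
def columnNormMatrix {n p : ℕ} (A : Matrix (Fin n) (Fin p) ℝ) : Matrix (Fin p) (Fin p) ℝ :=
  Matrix.diagonal fun j => ‖WithLp.toLp 2 (fun i => A i j)‖

/-- The standardized predictor matrix `M X W_{MX}⁻¹`. -/
def standardizedMatrix {n p : ℕ} (X : Matrix (Fin n) (Fin p) ℝ) : Matrix (Fin n) (Fin p) ℝ :=
  centeringMatrix n * X * (columnNormMatrix (centeringMatrix n * X))⁻¹

/-- The nullity of `D`: the dimension of its null space. -/
def matrixNullity {m p : ℕ} (D : Matrix (Fin m) (Fin p) ℝ) : ℕ :=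
  Module.finrank ℝ (LinearMap.ker D.mulVecLin)

end

/-! Write Z for the standardized matrix. The midpoint β of two solutions is a solution, and
convexity forces their difference into ker Z and into N_s = {v : (Dv)_i = 0 where s_i = 0}, with s =
sign(Dβ). It suffices to treat each of the finitely many patterns s for almost every X; y plays no
role.

Genericity (`ae_injective_columnCombination`): Z is a.s. injective on any fixed subspace of
dimension at most n - 1. If dim N_s ≤ n - 1, the difference is therefore zero. Otherwise let g(v) =
∑ s_i (Dv)_i. If g vanishes on N_s, then ‖Dβ‖₁ = g(β) = 0, so the difference lies in null(D), where
Z is injective. If not, an (n - 1)-dimensional L in N_s ∩ ker g is mapped by Z onto the whole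
hyperplane of centred vectors; correcting by L produces a vector of N_s ∩ ker Z with g ≠ 0, which
contradicts first-order optimality at β.

Existence is coercivity, from null(Z) ∩ null(D) = 0. -/

noncomputable section

open Matrix

/-! ### Generic injectivity on a fixed subspace -/

/-- The combination with coefficients `v` of the columns of `X`, each transformed by `φ`. -/
def columnCombination {n p : ℕ} (φ : (Fin n → ℝ) → Fin n → ℝ) (X : Fin n → Fin p → ℝ) :
    (Fin p → ℝ) →ₗ[ℝ] (Fin n → ℝ) :=
  Fintype.linearCombination ℝ fun j => φ fun i => X i j

theorem columnCombination_apply {n p : ℕ} (φ : (Fin n → ℝ) → Fin n → ℝ) (X : Fin n → Fin p → ℝ)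
    (v : Fin p → ℝ) : columnCombination φ X v = ∑ j, v j • φ fun i => X i j := rfl

/-- The linear map that places a vector in the `j`-th column of a matrix. -/
def columnEmbedding (n : ℕ) {p : ℕ} (j : Fin p) : (Fin n → ℝ) →ₗ[ℝ] (Fin n → Fin p → ℝ) :=
  LinearMap.pi fun i => LinearMap.single ℝ (fun _ => ℝ) j ∘ₗ LinearMap.proj i

theorem columnEmbedding_apply_self {n p : ℕ} (j : Fin p) (x : Fin n → ℝ) (i : Fin n) :
    columnEmbedding n j x i j = x i := by
  simp [columnEmbedding]

theorem columnEmbedding_apply_of_ne {n p : ℕ} {j k : Fin p} (h : k ≠ j) (x : Fin n → ℝ)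
    (i : Fin n) : columnEmbedding n j x i k = 0 := by
  simp [columnEmbedding, h]

/-- Injectivity on a fixed subspace is a measurable condition on the matrix. -/
theorem measurableSet_injective_columnCombination {n p : ℕ} {φ : (Fin n → ℝ) → Fin n → ℝ}
    (hφ : Measurable φ) (L : Submodule ℝ (Fin p → ℝ)) :
    MeasurableSet {X : Fin n → Fin p → ℝ | ∀ v ∈ L, columnCombination φ X v = 0 → v = 0} := by
  let b := Module.finBasis ℝ L
  -- Injectivity on `L` means that the images of a basis are independent, an open condition on those
  -- images.
  have h : {X : Fin n → Fin p → ℝ | ∀ v ∈ L, columnCombination φ X v = 0 → v = 0} =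
      (fun X k => columnCombination φ X (b k : Fin p → ℝ)) ⁻¹'
        {f : Fin (Module.finrank ℝ L) → Fin n → ℝ | LinearIndependent ℝ f} := by
    ext X
    simp only [Set.mem_ofPred_eq, Set.mem_preimage]
    have key : LinearIndependent ℝ (fun k => columnCombination φ X (b k : Fin p → ℝ)) ↔
        LinearMap.ker ((columnCombination φ X).domRestrict L) = ⊥ := by
      constructor
      · intro h
        rw [LinearMap.ker_eq_bot']
        intro w hw
        rw [← b.sum_repr w] at hw ⊢
        rw [map_sum] at hw
        simp only [map_smul, LinearMap.domRestrict_apply] at hw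
        have := Fintype.linearIndependent_iff.1 h _ hw
        simp [this]
      · intro h
        exact b.linearIndependent.map' _ h
    rw [key, LinearMap.ker_eq_bot']
    constructor
    · intro h w hw
      exact Subtype.ext (h w w.2 hw)
    · intro h v hv hz
      exact congrArg Subtype.val (h ⟨v, hv⟩ hz)
  rw [h]
  refine measurableSet_preimage ?_ isOpen_setOfPred_linearIndependent.measurableSet
  refine measurable_pi_lambda _ fun k => ?_
  simp only [columnCombination_apply]
  refine Finset.measurable_sum _ fun j _ => ?_
  have hcol : Measurable fun X : Fin n → Fin p → ℝ => fun i => X i j := by fun_prop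
  exact (hφ.comp hcol).const_smul ((b k : Fin p → ℝ) j)

/-- A proper subspace has a nonzero normal vector. -/
theorem exists_dotProduct_eq_zero_of_finrank {n : ℕ} (V : Submodule ℝ (Fin n → ℝ))
    (hV : Module.finrank ℝ V < n) : ∃ h : Fin n → ℝ, h ≠ 0 ∧ ∀ v ∈ V, h ⬝ᵥ v = 0 := by
  have hlt : V < ⊤ := by
    refine lt_top_iff_ne_top.2 fun h => ?_
    rw [h, finrank_top, Module.finrank_fin_fun] at hV
    exact lt_irrefl _ hV
  obtain ⟨f, hf, hVf⟩ := V.exists_le_ker_of_lt_top hlt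
  refine ⟨(dotProductEquiv ℝ (Fin n)).symm f, by simpa using hf, fun v hv => ?_⟩
  have : dotProductEquiv ℝ (Fin n) ((dotProductEquiv ℝ (Fin n)).symm f) v = 0 := by
    rw [LinearEquiv.apply_symm_apply]
    exact hVf hv
  exact this

/-- A subspace of dimension at most `n - 2` has a nonzero centred normal vector. -/
theorem exists_sum_eq_zero_dotProduct_eq_zero {n : ℕ} (V : Submodule ℝ (Fin n → ℝ))
    (hV : Module.finrank ℝ V + 2 ≤ n) :
    ∃ h : Fin n → ℝ, h ≠ 0 ∧ ∑ i, h i = 0 ∧ ∀ v ∈ V, h ⬝ᵥ v = 0 := by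
  obtain ⟨h, h0, hh⟩ := exists_dotProduct_eq_zero_of_finrank
    (V ⊔ Submodule.span ℝ {(1 : Fin n → ℝ)}) (by
      have := Submodule.finrank_add_le_finrank_add_finrank V (Submodule.span ℝ {(1 : Fin n → ℝ)})
      have := finrank_span_le_card (R := ℝ) {(1 : Fin n → ℝ)}
      rw [Set.toFinset_singleton, Finset.card_singleton] at this
      omega)
  refine ⟨h, h0, ?_, fun v hv => hh v (Submodule.mem_sup_left hv)⟩
  simpa [dotProduct_one] using hh 1 (Submodule.mem_sup_right (Submodule.mem_span_singleton_self _))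

/-- If no level set of a nonzero centred linear functional of `φ` has positive measure, then for
almost every `X` the map `v ↦ ∑ v_j φ(X_j)` is injective on a fixed subspace of dimension at most
`n - 1`. -/
theorem ae_injective_columnCombination {n p : ℕ} {φ : (Fin n → ℝ) → Fin n → ℝ}
    (hφ : Measurable φ)
    (hlevel : ∀ h : Fin n → ℝ, h ≠ 0 → ∑ i, h i = 0 → ∀ γ : ℝ, ∀ᵐ x : Fin n → ℝ, h ⬝ᵥ φ x ≠ γ)
    (d : ℕ) (hd : d + 1 ≤ n) (L : Submodule ℝ (Fin p → ℝ)) (hL : Module.finrank ℝ L ≤ d) :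
    ∀ᵐ X : Fin n → Fin p → ℝ, ∀ v ∈ L, columnCombination φ X v = 0 → v = 0 := by
  induction d generalizing L with
  | zero =>
    have : L = ⊥ := Submodule.finrank_eq_zero.1 (by omega)
    subst this
    exact Filter.Eventually.of_forall fun X v hv _ => by simpa using hv
  | succ d ih =>
    by_cases hbot : L = ⊥
    · subst hbot
      exact Filter.Eventually.of_forall fun X v hv _ => by simpa using hv
    obtain ⟨l', hl', hl0⟩ := Submodule.exists_mem_ne_zero_of_ne_bot hbot
    obtain ⟨j, hj⟩ := Function.ne_iff.1 hl0
    obtain ⟨l, hl, hlj⟩ : ∃ l ∈ L, l j = 1 :=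
      ⟨(l' j)⁻¹ • l', L.smul_mem _ hl', by simpa using inv_mul_cancel₀ hj⟩
    let L₀ := L ⊓ LinearMap.ker (LinearMap.proj j : (Fin p → ℝ) →ₗ[ℝ] ℝ)
    have hlt : L₀ < L := by
      refine lt_of_le_of_ne inf_le_left fun h => ?_
      have : l ∈ L₀ := h ▸ hl
      have h2 : l j = 0 := this.2
      rw [hlj] at h2
      exact one_ne_zero h2
    have hL₀ : Module.finrank ℝ L₀ ≤ d := by
      have := Submodule.finrank_lt_finrank_of_lt hlt
      omega
    -- Fubini: freeze the other columns and vary only column `j`, on which the restriction to `L₀`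
    -- does not depend.
    refine (ae_ae_add_linearMap_mem_iff (columnEmbedding n j) volume volume
      (measurableSet_injective_columnCombination hφ L)).1 ?_
    filter_upwards [ih (by omega) L₀ hL₀] with X hX
    obtain ⟨h, h0, hsum, hperp⟩ := exists_sum_eq_zero_dotProduct_eq_zero
      (L₀.map (columnCombination φ X)) (by
        have := Submodule.finrank_map_le (columnCombination φ X) L₀
        omega)
    -- If `v` is in the kernel and `v j ≠ 0`, then `v - v j • l` lies in `L₀`; pairing its image
    -- with `h` puts the new column on the level set of this value.
    let γ : ℝ := -(h ⬝ᵥ ∑ k ∈ Finset.univ.erase j, l k • φ fun i => X i k)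
    have hshift : ∀ᵐ x : Fin n → ℝ, h ⬝ᵥ φ ((fun i => X i j) + x) ≠ γ :=
      (measurePreserving_add_left volume (fun i => X i j)).quasiMeasurePreserving.ae
        (hlevel h h0 hsum γ)
    filter_upwards [hshift] with x hx v hv hvx
    have hsplit : ∀ u : Fin p → ℝ, columnCombination φ (X + columnEmbedding n j x) u =
        u j • φ ((fun i => X i j) + x) +
          ∑ k ∈ Finset.univ.erase j, u k • φ fun i => X i k := by
      intro u
      rw [columnCombination_apply, ← Finset.add_sum_erase _ _ (Finset.mem_univ j)]
      congr 1
      · congr 2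
        ext i
        simp [columnEmbedding_apply_self]
      · refine Finset.sum_congr rfl fun k hk => ?_
        congr 2
        ext i
        simp [columnEmbedding_apply_of_ne (Finset.ne_of_mem_erase hk)]
    have hold : ∀ u ∈ L₀, columnCombination φ X u =
        ∑ k ∈ Finset.univ.erase j, u k • φ fun i => X i k := by
      intro u hu
      have huj : u j = 0 := hu.2
      rw [columnCombination_apply, ← Finset.add_sum_erase _ _ (Finset.mem_univ j), huj]
      simp
    by_cases hvj : v j = 0
    · have hv₀ : v ∈ L₀ := ⟨hv, hvj⟩
      refine hX v hv₀ ?_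
      rw [hold v hv₀]
      rw [hsplit, hvj, zero_smul, zero_add] at hvx
      exact hvx
    · exfalso
      have hu : v - v j • l ∈ L₀ := ⟨L.sub_mem hv (L.smul_mem _ hl), by simp [hlj]⟩
      have h1 := hperp _ (Submodule.mem_map_of_mem hu)
      rw [hold _ hu] at h1
      have h2 : ∑ k ∈ Finset.univ.erase j, (v - v j • l) k • (φ fun i => X i k) =
          (∑ k ∈ Finset.univ.erase j, v k • φ fun i => X i k) -
            v j • ∑ k ∈ Finset.univ.erase j, l k • φ fun i => X i k := by
        rw [Finset.smul_sum, ← Finset.sum_sub_distrib]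
        refine Finset.sum_congr rfl fun k _ => ?_
        simp [sub_smul, mul_smul]
      rw [hsplit] at hvx
      rw [h2, eq_neg_of_add_eq_zero_right hvx, dotProduct_sub, dotProduct_neg,
        dotProduct_smul, dotProduct_smul] at h1
      refine hx (mul_left_cancel₀ hvj ?_)
      simp only [smul_eq_mul] at h1
      simp only [γ]
      linarith

/-! ### Existence of a solution -/

theorem genLassoCriterion_eq {n p m : ℕ} (y : Fin n → ℝ) (A : Matrix (Fin n) (Fin p) ℝ)
    (D : Matrix (Fin m) (Fin p) ℝ) (lam : ℝ) (β : Fin p → ℝ) :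
    genLassoCriterion y A D lam β =
      (1 / 2) * ∑ i, (y i - (A *ᵥ β) i) ^ 2 + lam * ∑ i, |(D *ᵥ β) i| := by
  simp [genLassoCriterion, EuclideanSpace.real_norm_sq_eq, PiLp.norm_eq_of_L1]

theorem continuous_genLassoCriterion {n p m : ℕ} (y : Fin n → ℝ) (A : Matrix (Fin n) (Fin p) ℝ)
    (D : Matrix (Fin m) (Fin p) ℝ) (lam : ℝ) : Continuous (genLassoCriterion y A D lam) := by
  have h : genLassoCriterion y A D lam = fun β =>
      (1 / 2) * ∑ i, (y i - (A *ᵥ β) i) ^ 2 + lam * ∑ i, |(D *ᵥ β) i| :=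
    funext (genLassoCriterion_eq y A D lam)
  rw [h]
  simp only [mulVec, dotProduct]
  fun_prop

/-- If the null spaces of the predictor and penalty matrices meet only in zero, the criterion is
coercive, hence attains its minimum. -/
theorem exists_isGenLassoSolution {n p m : ℕ} (y : Fin n → ℝ) (A : Matrix (Fin n) (Fin p) ℝ)
    (D : Matrix (Fin m) (Fin p) ℝ) {lam : ℝ} (hlam : 0 < lam)
    (hker : ∀ v, D *ᵥ v = 0 → A *ᵥ v = 0 → v = 0) :
    ∃ β, IsGenLassoSolution y A D lam β := by
  let T : (Fin p → ℝ) →ₗ[ℝ] (Fin n → ℝ) × (Fin m → ℝ) := A.mulVecLin.prod D.mulVecLin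
  have hT : LinearMap.ker T = ⊥ := by
    rw [LinearMap.ker_eq_bot']
    intro v hv
    exact hker v (congrArg Prod.snd hv) (congrArg Prod.fst hv)
  obtain ⟨K, -, hK⟩ := T.exists_antilipschitzWith hT
  have hbound : ∀ β, ‖T β‖ ≤
      genLassoCriterion y A D lam β * (1 + 1 / lam) + (‖y‖ + 1) := by
    intro β
    have hf := genLassoCriterion_eq y A D lam β
    set f := genLassoCriterion y A D lam β
    have hS1 : 0 ≤ ∑ i, (y i - (A *ᵥ β) i) ^ 2 := Finset.sum_nonneg fun i _ => sq_nonneg _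
    have hS2 : 0 ≤ ∑ i, |(D *ᵥ β) i| := Finset.sum_nonneg fun i _ => abs_nonneg _
    have hf0 : 0 ≤ f := by rw [hf]; positivity
    have hfl : 0 ≤ f * (1 / lam) := by positivity
    have hy := norm_nonneg y
    refine norm_prod_le_iff.2 ⟨(pi_norm_le_iff_of_nonneg (by nlinarith)).2 fun i => ?_,
      (pi_norm_le_iff_of_nonneg (by nlinarith)).2 fun i => ?_⟩
    · have h1 : (y i - (A *ᵥ β) i) ^ 2 ≤ ∑ i, (y i - (A *ᵥ β) i) ^ 2 :=
        Finset.single_le_sum (f := fun i => (y i - (A *ᵥ β) i) ^ 2)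
          (fun i _ => sq_nonneg _) (Finset.mem_univ i)
      have h2 : (y i - (A *ᵥ β) i) ^ 2 ≤ 2 * f := by
        have : 0 ≤ lam * ∑ i, |(D *ᵥ β) i| := by positivity
        linarith
      have h3 : |y i - (A *ᵥ β) i| ≤ f + 1 := by
        rw [abs_le]
        constructor <;> nlinarith [sq_nonneg (y i - (A *ᵥ β) i - 1),
          sq_nonneg (y i - (A *ᵥ β) i + 1)]
      have h4 : |y i| ≤ ‖y‖ := norm_le_pi_norm y i
      have h5 : |(A *ᵥ β) i| ≤ |y i| + |y i - (A *ᵥ β) i| := by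
        have := abs_sub (y i) (y i - (A *ᵥ β) i)
        rwa [sub_sub_cancel] at this
      change |(A *ᵥ β) i| ≤ _
      linarith
    · have h1 : |(D *ᵥ β) i| ≤ ∑ i, |(D *ᵥ β) i| :=
        Finset.single_le_sum (f := fun i => |(D *ᵥ β) i|)
          (fun i _ => abs_nonneg _) (Finset.mem_univ i)
      have h2 : ∑ i, |(D *ᵥ β) i| ≤ f * (1 / lam) := by
        rw [mul_one_div, le_div_iff₀ hlam]
        linarith
      change |(D *ᵥ β) i| ≤ _
      linarith
  have htend : Filter.Tendsto (genLassoCriterion y A D lam) (Filter.cocompact _) Filter.atTop := by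
    have h1 : Filter.Tendsto (fun β => ‖T β‖) (Filter.cocompact _) Filter.atTop :=
      tendsto_norm_cocompact_atTop.comp
        (hK.isClosedEmbedding
          (LinearMap.toContinuousLinearMap T).uniformContinuous).tendsto_cocompact
    have h2 := Filter.tendsto_atTop_mono hbound h1
    have hc : 0 < 1 + 1 / lam := by positivity
    exact (Filter.tendsto_mul_const_atTop_of_pos hc).1
      (by simpa only [add_neg_cancel_right] using
        Filter.tendsto_atTop_add_const_right _ (-(‖y‖ + 1)) h2)
  exact (continuous_genLassoCriterion y A D lam).exists_forall_le htend

/-! ### Deterministic uniqueness criterion -/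

/-- The vectors `v` for which `D v` is supported on the support of the sign pattern `s`. -/
def signSubspace {p m : ℕ} (D : Matrix (Fin m) (Fin p) ℝ) (s : Fin m → SignType) :
    Submodule ℝ (Fin p → ℝ) where
  carrier := {v | ∀ i, s i = 0 → (D *ᵥ v) i = 0}
  zero_mem' := by simp
  add_mem' := fun {a b} ha hb i hi => by simp [mulVec_add, ha i hi, hb i hi]
  smul_mem' := fun c a ha i hi => by simp [mulVec_smul, ha i hi]

/-- The linear functional `v ↦ ∑ s_i (D v)_i`. -/
def signFunctional {p m : ℕ} (D : Matrix (Fin m) (Fin p) ℝ) (s : Fin m → SignType) :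
    (Fin p → ℝ) →ₗ[ℝ] ℝ :=
  dotProductEquiv ℝ (Fin m) (fun i => (s i : ℝ)) ∘ₗ D.mulVecLin

theorem signFunctional_apply {p m : ℕ} (D : Matrix (Fin m) (Fin p) ℝ) (s : Fin m → SignType)
    (v : Fin p → ℝ) : signFunctional D s v = ∑ i, (s i : ℝ) * (D *ᵥ v) i := rfl

theorem eventually_abs_add_mul_eq {c : ℝ} (hc : c ≠ 0) (d : ℝ) :
    ∀ᶠ t in nhds (0 : ℝ), |c + t * d| = |c| + t * ((SignType.sign c : ℝ) * d) := by
  have hcont : Filter.Tendsto (fun t : ℝ => c + t * d) (nhds 0) (nhds c) := by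
    have : Continuous fun t : ℝ => c + t * d := by fun_prop
    simpa using this.tendsto 0
  rcases lt_or_gt_of_ne hc with h | h
  · filter_upwards [hcont.eventually_lt_const h] with t ht
    rw [abs_of_neg ht, abs_of_neg h, sign_neg h]
    simp
    ring
  · filter_upwards [hcont.eventually_const_lt h] with t ht
    rw [abs_of_pos ht, abs_of_pos h, sign_pos h]
    simp

/-- First-order optimality along directions in the null space of the predictor matrix. -/
theorem IsGenLassoSolution.signFunctional_eq_zero {n p m : ℕ} {y : Fin n → ℝ}
    {A : Matrix (Fin n) (Fin p) ℝ} {D : Matrix (Fin m) (Fin p) ℝ} {lam : ℝ} (hlam : 0 < lam)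
    {β : Fin p → ℝ} (hβ : IsGenLassoSolution y A D lam β) {w : Fin p → ℝ}
    (hw : w ∈ signSubspace D fun i => SignType.sign ((D *ᵥ β) i)) (hAw : A *ᵥ w = 0) :
    signFunctional D (fun i => SignType.sign ((D *ᵥ β) i)) w = 0 := by
  set g := signFunctional D (fun i => SignType.sign ((D *ᵥ β) i)) w with hg
  have hev : ∀ᶠ t in nhds (0 : ℝ), ∀ i, |(D *ᵥ β) i + t * (D *ᵥ w) i| =
      |(D *ᵥ β) i| + t * ((SignType.sign ((D *ᵥ β) i) : ℝ) * (D *ᵥ w) i) := by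
    refine Filter.eventually_all.2 fun i => ?_
    by_cases hi : (D *ᵥ β) i = 0
    · have : (D *ᵥ w) i = 0 := hw i (by simp [hi])
      simp [hi, this]
    · exact eventually_abs_add_mul_eq hi _
  -- For small `t` no nonzero coordinate of `D β` changes sign and the fit is constant, so the
  -- criterion changes by exactly `lam * (t * g)`.
  have hmin : IsLocalMin (fun t : ℝ => t * g) 0 := by
    filter_upwards [hev] with t ht
    have h := hβ (β + t • w)
    rw [genLassoCriterion_eq, genLassoCriterion_eq, mulVec_add, mulVec_smul, hAw, smul_zero,
      add_zero, mulVec_add, mulVec_smul] at h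
    have h2 : ∑ i, |(D *ᵥ β + t • D *ᵥ w) i| = ∑ i, |(D *ᵥ β) i| + t * g := by
      rw [hg, signFunctional_apply, Finset.mul_sum, ← Finset.sum_add_distrib]
      exact Finset.sum_congr rfl fun i _ => by simpa using ht i
    rw [h2] at h
    have h3 : 0 ≤ lam * (t * g) := by linarith
    simpa using nonneg_of_mul_nonneg_right h3 hlam
  have hd : HasDerivAt (fun t : ℝ => t * g) g 0 := by
    simpa using (hasDerivAt_id (0 : ℝ)).mul_const g
  exact hmin.hasDerivAt_eq_zero hd

/-- Uniqueness of the generalized lasso solution under a condition on the predictor matrix only. -/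
theorem existsUnique_isGenLassoSolution {n p m : ℕ} (y : Fin n → ℝ)
    (A : Matrix (Fin n) (Fin p) ℝ) (D : Matrix (Fin m) (Fin p) ℝ) {lam : ℝ} (hlam : 0 < lam)
    (hker : ∀ v, D *ᵥ v = 0 → A *ᵥ v = 0 → v = 0)
    (hsign : ∀ s : Fin m → SignType, (∀ v ∈ signSubspace D s, A *ᵥ v = 0 → v = 0) ∨
      (∀ v ∈ signSubspace D s, signFunctional D s v = 0) ∨
      ∃ v ∈ signSubspace D s, A *ᵥ v = 0 ∧ signFunctional D s v ≠ 0) :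
    ∃! β, IsGenLassoSolution y A D lam β := by
  obtain ⟨β₁, h₁⟩ := exists_isGenLassoSolution y A D hlam hker
  refine ⟨β₁, h₁, fun β₂ h₂ => ?_⟩
  let β := (1 / 2 : ℝ) • (β₁ + β₂)
  have h12 : genLassoCriterion y A D lam β₁ = genLassoCriterion y A D lam β₂ :=
    le_antisymm (h₁ _) (h₂ _)
  have hAβ : ∀ i, (A *ᵥ β) i = ((A *ᵥ β₁) i + (A *ᵥ β₂) i) / 2 := fun i => by
    simp [β, mulVec_smul, mulVec_add]; ring
  have hDβ : ∀ i, (D *ᵥ β) i = ((D *ᵥ β₁) i + (D *ᵥ β₂) i) / 2 := fun i => by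
    simp [β, mulVec_smul, mulVec_add]; ring
  have habs : ∀ i, 0 ≤ |(D *ᵥ β₁) i| + |(D *ᵥ β₂) i| - 2 * |(D *ᵥ β) i| := fun i => by
    rw [hDβ, abs_div, abs_two]
    linarith [abs_add_le ((D *ᵥ β₁) i) ((D *ᵥ β₂) i)]
  -- The midpoint convexity gap is a sum of two nonnegative terms; minimality of `β₁` and `β₂` makes
  -- both vanish.
  have hid : genLassoCriterion y A D lam β₁ + genLassoCriterion y A D lam β₂ -
      2 * genLassoCriterion y A D lam β = (1 / 4) * ∑ i, ((A *ᵥ β₂) i - (A *ᵥ β₁) i) ^ 2 +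
        lam * ∑ i, (|(D *ᵥ β₁) i| + |(D *ᵥ β₂) i| - 2 * |(D *ᵥ β) i|) := by
    simp only [genLassoCriterion_eq, Finset.sum_sub_distrib, Finset.sum_add_distrib,
      ← Finset.mul_sum]
    have : ∑ i, ((A *ᵥ β₂) i - (A *ᵥ β₁) i) ^ 2 = 2 * ∑ i, (y i - (A *ᵥ β₁) i) ^ 2 +
        2 * ∑ i, (y i - (A *ᵥ β₂) i) ^ 2 - 4 * ∑ i, (y i - (A *ᵥ β) i) ^ 2 := by
      simp only [Finset.mul_sum, ← Finset.sum_sub_distrib, ← Finset.sum_add_distrib, hAβ]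
      exact Finset.sum_congr rfl fun i _ => by ring
    rw [this]
    ring
  have hS1 : 0 ≤ ∑ i, ((A *ᵥ β₂) i - (A *ᵥ β₁) i) ^ 2 := Finset.sum_nonneg fun i _ => sq_nonneg _
  have hS2 : 0 ≤ ∑ i, (|(D *ᵥ β₁) i| + |(D *ᵥ β₂) i| - 2 * |(D *ᵥ β) i|) :=
    Finset.sum_nonneg fun i _ => habs i
  have hS2' := mul_nonneg hlam.le hS2
  have hle := h₁ β
  have hβ : IsGenLassoSolution y A D lam β := fun β' => by
    have := h₁ β'
    linarith
  have hS1z : ∑ i, ((A *ᵥ β₂) i - (A *ᵥ β₁) i) ^ 2 = 0 := by linarith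
  have hS2z : ∑ i, (|(D *ᵥ β₁) i| + |(D *ᵥ β₂) i| - 2 * |(D *ᵥ β) i|) = 0 := by
    have : lam * ∑ i, (|(D *ᵥ β₁) i| + |(D *ᵥ β₂) i| - 2 * |(D *ᵥ β) i|) = 0 := by linarith
    exact (mul_eq_zero.1 this).resolve_left hlam.ne'
  rw [Finset.sum_eq_zero_iff_of_nonneg fun i _ => sq_nonneg _] at hS1z
  rw [Finset.sum_eq_zero_iff_of_nonneg fun i _ => habs i] at hS2z
  have hAv : A *ᵥ (β₂ - β₁) = 0 := by
    ext i
    simpa [mulVec_sub] using hS1z i (Finset.mem_univ i)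
  let s : Fin m → SignType := fun i => SignType.sign ((D *ᵥ β) i)
  have hv : β₂ - β₁ ∈ signSubspace D s := fun i hi => by
    have hi0 : (D *ᵥ β) i = 0 := sign_eq_zero_iff.1 hi
    have h := hS2z i (Finset.mem_univ i)
    rw [hi0, abs_zero, mul_zero, sub_zero] at h
    have ha := abs_nonneg ((D *ᵥ β₁) i)
    have hb := abs_nonneg ((D *ᵥ β₂) i)
    have h1 : (D *ᵥ β₁) i = 0 := abs_eq_zero.1 (by linarith)
    have h2 : (D *ᵥ β₂) i = 0 := abs_eq_zero.1 (by linarith)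
    simp [mulVec_sub, h1, h2]
  rcases hsign s with h | h | ⟨w, hw, hAw, hgw⟩
  · exact sub_eq_zero.1 (h _ hv hAv)
  -- On `β` itself the functional is the ℓ¹ norm of `D β`, so `s = 0` and the difference lies in the
  -- null space of `D`.
  · have hβs : β ∈ signSubspace D s := fun i hi => sign_eq_zero_iff.1 hi
    have hz := h β hβs
    rw [signFunctional_apply, Finset.sum_eq_zero_iff_of_nonneg fun i _ => by
      rw [sign_mul_self]; exact abs_nonneg _] at hz
    have hDβ0 : ∀ i, (D *ᵥ β) i = 0 := fun i => by
      have := hz i (Finset.mem_univ i)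
      rw [sign_mul_self] at this
      exact abs_eq_zero.1 this
    refine sub_eq_zero.1 (hker _ ?_ hAv)
    ext i
    exact hv i (sign_eq_zero_iff.2 (hDβ0 i))
  · exact absurd (hβ.signFunctional_eq_zero hlam hw hAw) hgw

/-! ### Centring, scaling and their level sets -/

theorem centeringMatrix_mulVec_apply {n : ℕ} (x : Fin n → ℝ) (i : Fin n) :
    (centeringMatrix n *ᵥ x) i = x i - (n : ℝ)⁻¹ * ∑ k, x k := by
  simp [centeringMatrix, sub_mulVec, smul_mulVec, vecMulVec_mulVec, dotProduct]

theorem sum_centeringMatrix_mulVec {n : ℕ} (x : Fin n → ℝ) :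
    ∑ i, (centeringMatrix n *ᵥ x) i = 0 := by
  rcases Nat.eq_zero_or_pos n with rfl | hn
  · simp
  · have : (n : ℝ) ≠ 0 := by positivity
    simp [centeringMatrix_mulVec_apply, Finset.sum_sub_distrib, mul_inv_cancel_left₀ this]

theorem centeringMatrix_mulVec_of_sum_eq_zero {n : ℕ} {x : Fin n → ℝ} (hx : ∑ i, x i = 0) :
    centeringMatrix n *ᵥ x = x := by
  ext i
  simp [centeringMatrix_mulVec_apply, hx]

theorem dotProduct_centeringMatrix_mulVec {n : ℕ} {h : Fin n → ℝ} (hsum : ∑ i, h i = 0)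
    (x : Fin n → ℝ) : h ⬝ᵥ centeringMatrix n *ᵥ x = h ⬝ᵥ x := by
  simp only [dotProduct, centeringMatrix_mulVec_apply, mul_sub, Finset.sum_sub_distrib]
  rw [← Finset.sum_mul, hsum, zero_mul, sub_zero]

theorem measurable_centeringMatrix_mulVec (n : ℕ) :
    Measurable fun x : Fin n → ℝ => centeringMatrix n *ᵥ x :=
  (centeringMatrix n).mulVecLin.continuous_of_finiteDimensional.measurable

/-- The centred vector `M x`, scaled to unit Euclidean length. -/
def standardizedVector {n : ℕ} (x : Fin n → ℝ) : Fin n → ℝ :=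
  ‖WithLp.toLp 2 (centeringMatrix n *ᵥ x)‖⁻¹ • centeringMatrix n *ᵥ x

theorem measurable_standardizedVector (n : ℕ) :
    Measurable (standardizedVector : (Fin n → ℝ) → Fin n → ℝ) := by
  have h := measurable_centeringMatrix_mulVec n
  have h2 : Measurable fun x : Fin n → ℝ => ‖WithLp.toLp 2 (centeringMatrix n *ᵥ x)‖ :=
    ((PiLp.continuous_toLp 2 fun _ : Fin n => ℝ).measurable.comp h).norm
  exact h2.inv.smul h

theorem ae_quadratic_ne_zero {a b c : ℝ} (h : a ≠ 0 ∨ b ≠ 0) :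
    ∀ᵐ t : ℝ, a * t ^ 2 + b * t + c ≠ 0 := by
  let q : Polynomial ℝ := Polynomial.C a * Polynomial.X ^ 2 + Polynomial.C b * Polynomial.X +
    Polynomial.C c
  have hq : q ≠ 0 := by
    intro h0
    have h2 : q.coeff 2 = a := by simp [q]
    have h1 : q.coeff 1 = b := by simp [q]
    rw [h0, Polynomial.coeff_zero] at h1 h2
    rcases h with h | h
    · exact h h2.symm
    · exact h h1.symm
  have hfin : {t : ℝ | q.IsRoot t}.Finite := Polynomial.finite_setOfPred_isRoot hq
  filter_upwards [compl_mem_ae_iff.2 (hfin.measure_zero volume)] with t ht h0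
  exact ht (by simpa [q, Polynomial.IsRoot] using h0)

theorem ae_dotProduct_centeringMatrix_mulVec_ne {n : ℕ} {h : Fin n → ℝ} (h0 : h ≠ 0)
    (hsum : ∑ i, h i = 0) (γ : ℝ) :
    ∀ᵐ x : Fin n → ℝ, h ⬝ᵥ centeringMatrix n *ᵥ x ≠ γ := by
  have hms : MeasurableSet {x : Fin n → ℝ | h ⬝ᵥ centeringMatrix n *ᵥ x ≠ γ} := by
    have := measurable_centeringMatrix_mulVec n
    simp only [dotProduct]
    exact (measurableSet_singleton γ).compl.preimage (by fun_prop)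
  refine ae_mem_of_ae_add_linearMap_mem (LinearMap.toSpanSingleton ℝ (Fin n → ℝ) h) volume volume
    hms fun z => ?_
  have hh : h ⬝ᵥ h ≠ 0 := fun h' => h0 (dotProduct_self_eq_zero.1 h')
  filter_upwards [ae_quadratic_ne_zero (a := 0) (c := h ⬝ᵥ z - γ) (Or.inr hh)] with t ht heq
  rw [dotProduct_centeringMatrix_mulVec hsum, LinearMap.toSpanSingleton_apply, dotProduct_add,
    dotProduct_smul, smul_eq_mul] at heq
  exact ht (by linarith)

/-- Squaring h·Mx = γ‖Mx‖ confines the level set to the zero set of a quadratic, which is null once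
it is nontrivial along some direction `u`. For `γ = 0` take `u = h`; otherwise take `u` nonzero,
centred and orthogonal to `h`, which needs `n ≥ 3`. For `n = 2` only two centred unit vectors exist
and level sets can have positive measure. -/
theorem ae_dotProduct_standardizedVector_ne {n : ℕ} (hn : 3 ≤ n) {h : Fin n → ℝ} (h0 : h ≠ 0)
    (hsum : ∑ i, h i = 0) (γ : ℝ) : ∀ᵐ x : Fin n → ℝ, h ⬝ᵥ standardizedVector x ≠ γ := by
  obtain ⟨u, hu⟩ : ∃ u : Fin n → ℝ, (h ⬝ᵥ u) ^ 2 -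
      γ ^ 2 * ((centeringMatrix n *ᵥ u) ⬝ᵥ (centeringMatrix n *ᵥ u)) ≠ 0 := by
    by_cases hγ : γ = 0
    · refine ⟨h, ?_⟩
      have hh : h ⬝ᵥ h ≠ 0 := fun h' => h0 (dotProduct_self_eq_zero.1 h')
      simpa [hγ] using hh
    · obtain ⟨u, hu0, husum, hu⟩ := exists_sum_eq_zero_dotProduct_eq_zero
        (Submodule.span ℝ {h}) (by
          rw [finrank_span_singleton h0]
          omega)
      refine ⟨u, ?_⟩
      rw [dotProduct_comm h u, hu h (Submodule.mem_span_singleton_self h),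
        centeringMatrix_mulVec_of_sum_eq_zero husum]
      have huu : u ⬝ᵥ u ≠ 0 := fun h' => hu0 (dotProduct_self_eq_zero.1 h')
      simpa [hγ] using huu
  have hms : MeasurableSet {x : Fin n → ℝ | h ⬝ᵥ standardizedVector x ≠ γ} := by
    have := measurable_standardizedVector n
    simp only [dotProduct]
    exact (measurableSet_singleton γ).compl.preimage (by fun_prop)
  refine ae_mem_of_ae_add_linearMap_mem (LinearMap.toSpanSingleton ℝ (Fin n → ℝ) u) volume volume
    hms fun z => ?_
  filter_upwards [ae_quadratic_ne_zero
    (b := 2 * (h ⬝ᵥ z) * (h ⬝ᵥ u) -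
      γ ^ 2 * (2 * ((centeringMatrix n *ᵥ z) ⬝ᵥ (centeringMatrix n *ᵥ u))))
    (c := (h ⬝ᵥ z) ^ 2 - γ ^ 2 * ((centeringMatrix n *ᵥ z) ⬝ᵥ (centeringMatrix n *ᵥ z)))
    (Or.inl hu)] with t ht heq
  have hx : ∀ x : Fin n → ℝ, h ⬝ᵥ standardizedVector x = γ →
      (h ⬝ᵥ x) ^ 2 = γ ^ 2 * ((centeringMatrix n *ᵥ x) ⬝ᵥ (centeringMatrix n *ᵥ x)) := by
    intro x hxγ
    have hnorm : ‖WithLp.toLp 2 (centeringMatrix n *ᵥ x)‖ ^ 2 =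
        (centeringMatrix n *ᵥ x) ⬝ᵥ (centeringMatrix n *ᵥ x) := by
      rw [EuclideanSpace.real_norm_sq_eq]
      simp [dotProduct, sq]
    rw [standardizedVector, dotProduct_smul, dotProduct_centeringMatrix_mulVec hsum,
      smul_eq_mul] at hxγ
    -- If `M x = 0`, the inverse norm is `0` by convention and both sides of the quadratic equation
    -- vanish.
    by_cases hz : ‖WithLp.toLp 2 (centeringMatrix n *ᵥ x)‖ = 0
    · have hMx : centeringMatrix n *ᵥ x = 0 := by simpa using hz
      have := dotProduct_centeringMatrix_mulVec hsum x
      rw [← this, hMx]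
      simp
    · rw [← hnorm, ← hxγ]
      field_simp
  have h2 := hx _ heq
  rw [LinearMap.toSpanSingleton_apply, dotProduct_add, dotProduct_smul, mulVec_add, mulVec_smul,
    add_dotProduct, dotProduct_add, dotProduct_add, smul_dotProduct, dotProduct_smul,
    smul_dotProduct, dotProduct_smul,
    dotProduct_comm (centeringMatrix n *ᵥ u) (centeringMatrix n *ᵥ z)] at h2
  simp only [smul_eq_mul] at h2
  exact ht (by linear_combination h2)

/-! ### Genericity of the standardized matrix -/

theorem ae_centeringMatrix_mulVec_column_ne_zero {n p : ℕ} (hn : 2 ≤ n) (j : Fin p) :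
    ∀ᵐ X : Fin n → Fin p → ℝ, centeringMatrix n *ᵥ (fun i => X i j) ≠ 0 := by
  have hrank : Module.finrank ℝ (Submodule.span ℝ {(Pi.single j 1 : Fin p → ℝ)}) = 1 :=
    finrank_span_singleton (by simp)
  have h := ae_injective_columnCombination (measurable_centeringMatrix_mulVec n)
    (fun h h0 hsum γ => ae_dotProduct_centeringMatrix_mulVec_ne h0 hsum γ) 1 hn _ hrank.le
  filter_upwards [h] with X hX h0
  have h1 := hX (Pi.single j 1) (Submodule.mem_span_singleton_self _) (by
    simp [columnCombination_apply, Pi.single_apply, h0])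
  simp at h1

/-- For almost every `X`, the standardized matrix is injective on a fixed subspace of dimension at
most `n - 1`, provided `p ≤ n - 1` or `n ≥ 3`. -/
theorem ae_injective_columnCombination_standardizedVector {n p : ℕ} (hnp : p + 1 ≤ n ∨ 3 ≤ n)
    (L : Submodule ℝ (Fin p → ℝ)) (hL : Module.finrank ℝ L + 1 ≤ n) :
    ∀ᵐ X : Fin n → Fin p → ℝ, ∀ v ∈ L, columnCombination standardizedVector X v = 0 → v = 0 := by
  rcases hnp with hp | hn
  -- Here `n = 2` is possible, so the columns are only centred; they are independent, and nonzero
  -- scalings preserve this.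
  · have h := ae_injective_columnCombination (measurable_centeringMatrix_mulVec n)
      (fun h h0 hsum γ => ae_dotProduct_centeringMatrix_mulVec_ne h0 hsum γ) p hp
      (⊤ : Submodule ℝ (Fin p → ℝ)) (by simp)
    have h2 : ∀ᵐ X : Fin n → Fin p → ℝ, ∀ j, centeringMatrix n *ᵥ (fun i => X i j) ≠ 0 :=
      ae_all_iff.2 fun j => ae_centeringMatrix_mulVec_column_ne_zero (by have := j.2; omega) j
    filter_upwards [h, h2] with X hX hX2 v _ hv
    have h3 := hX (fun j => v j * ‖WithLp.toLp 2 (centeringMatrix n *ᵥ fun i => X i j)‖⁻¹)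
      Submodule.mem_top (by
        rw [← hv, columnCombination_apply, columnCombination_apply]
        simp [standardizedVector, smul_smul])
    ext j
    have h4 := congrFun h3 j
    simpa [hX2 j] using h4
  · exact ae_injective_columnCombination (measurable_standardizedVector n)
      (fun h h0 hsum γ => ae_dotProduct_standardizedVector_ne hn h0 hsum γ) _ hL L le_rfl

theorem sum_columnCombination_standardizedVector {n p : ℕ} (X : Fin n → Fin p → ℝ)
    (v : Fin p → ℝ) : ∑ i, columnCombination standardizedVector X v i = 0 := by
  simp only [columnCombination_apply, Finset.sum_apply]
  rw [Finset.sum_comm]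
  refine Finset.sum_eq_zero fun j _ => ?_
  simp [standardizedVector, ← Finset.mul_sum, sum_centeringMatrix_mulVec]

/-- If `Z` is injective on a subspace of dimension `n - 1` and its values have zero sum, then the
subspace and the whole space have the same image under `Z`. -/
theorem exists_mem_map_eq {n p : ℕ} (hn : 1 ≤ n) (Z : (Fin p → ℝ) →ₗ[ℝ] (Fin n → ℝ))
    (hZ : ∀ v, ∑ i, Z v i = 0) (L : Submodule ℝ (Fin p → ℝ)) (hL : Module.finrank ℝ L + 1 = n)
    (hinj : ∀ v ∈ L, Z v = 0 → v = 0) (v : Fin p → ℝ) : ∃ l ∈ L, Z l = Z v := by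
  let H : Submodule ℝ (Fin n → ℝ) := LinearMap.ker (dotProductEquiv ℝ (Fin n) 1)
  have hmem : ∀ x, x ∈ H ↔ ∑ i, x i = 0 := fun x => by
    simp [H, one_dotProduct]
  have hH : Module.finrank ℝ H < n := by
    have : H < ⊤ := by
      refine lt_top_iff_ne_top.2 fun h => ?_
      have h1 : (1 : Fin n → ℝ) ∈ H := h ▸ Submodule.mem_top
      rw [hmem] at h1
      simp at h1
      omega
    have h2 := Submodule.finrank_lt this.ne
    rwa [Module.finrank_fin_fun] at h2
  have hle : L.map Z ≤ H := by
    rintro _ ⟨w, -, rfl⟩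
    exact (hmem _).2 (hZ w)
  have hrank : Module.finrank ℝ (L.map Z) = Module.finrank ℝ L := by
    have hinj' : Function.Injective (Z.domRestrict L) := by
      rw [← LinearMap.ker_eq_bot, LinearMap.ker_eq_bot']
      exact fun w hw => Subtype.ext (hinj w w.2 hw)
    rw [← LinearMap.finrank_range_of_inj hinj', LinearMap.range_domRestrict]
  -- Both have dimension `n - 1`.
  have heq : L.map Z = H := Submodule.eq_of_le_of_finrank_le hle (by omega)
  have hv : Z v ∈ L.map Z := heq ▸ (hmem _).2 (hZ v)
  exact hv

/-- A subspace of dimension greater than `d` contains a `d`-dimensional subspace on which a given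
linear functional vanishes. -/
theorem exists_le_le_ker_finrank_eq {E : Type*} [AddCommGroup E] [Module ℝ E]
    [FiniteDimensional ℝ E] (N : Submodule ℝ E) (g : E →ₗ[ℝ] ℝ) {d : ℕ}
    (hd : d + 1 ≤ Module.finrank ℝ N) :
    ∃ L : Submodule ℝ E, L ≤ N ∧ L ≤ LinearMap.ker g ∧ Module.finrank ℝ L = d := by
  have hker : d ≤ Module.finrank ℝ (LinearMap.ker (g.domRestrict N)) := by
    have h1 := LinearMap.finrank_range_add_finrank_ker (g.domRestrict N)
    have h2 := Submodule.finrank_le (LinearMap.range (g.domRestrict N))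
    rw [Module.finrank_self] at h2
    omega
  obtain ⟨f, hf⟩ := exists_linearIndependent_of_le_finrank hker
  have hf' : LinearIndependent ℝ fun k => ((f k : N) : E) :=
    (hf.map' (LinearMap.ker (g.domRestrict N)).subtype (Submodule.ker_subtype _)).map'
      N.subtype (Submodule.ker_subtype _)
  refine ⟨Submodule.span ℝ (Set.range fun k => ((f k : N) : E)), Submodule.span_le.2 ?_,
    Submodule.span_le.2 ?_, ?_⟩
  · rintro _ ⟨k, rfl⟩
    exact (f k : N).2
  · rintro _ ⟨k, rfl⟩
    exact (f k).2
  · rw [finrank_span_eq_card hf', Fintype.card_fin]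

/-- For almost every `X`, the standardized matrix satisfies the uniqueness condition for a fixed
sign pattern. -/
theorem ae_sign_condition {n p m : ℕ} (hn : 1 ≤ n) (hnp : p + 1 ≤ n ∨ 3 ≤ n)
    (D : Matrix (Fin m) (Fin p) ℝ) (s : Fin m → SignType) :
    ∀ᵐ X : Fin n → Fin p → ℝ,
      (∀ v ∈ signSubspace D s, columnCombination standardizedVector X v = 0 → v = 0) ∨
      (∀ v ∈ signSubspace D s, signFunctional D s v = 0) ∨
      ∃ v ∈ signSubspace D s,
        columnCombination standardizedVector X v = 0 ∧ signFunctional D s v ≠ 0 := by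
  by_cases hrank : Module.finrank ℝ (signSubspace D s) + 1 ≤ n
  · filter_upwards [ae_injective_columnCombination_standardizedVector hnp _ hrank] with X hX
    exact Or.inl hX
  by_cases hg : ∀ v ∈ signSubspace D s, signFunctional D s v = 0
  · exact Filter.Eventually.of_forall fun X => Or.inr (Or.inl hg)
  push Not at hg
  obtain ⟨v, hv, hgv⟩ := hg
  -- Since `L` lies in the kernel of the functional, subtracting `l ∈ L` can cancel the image of `v`
  -- without changing the functional's value.
  obtain ⟨L, hLs, hLg, hL⟩ := exists_le_le_ker_finrank_eq (signSubspace D s) (signFunctional D s)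
    (show n - 1 + 1 ≤ _ by omega)
  replace hL : Module.finrank ℝ L + 1 = n := by omega
  filter_upwards [ae_injective_columnCombination_standardizedVector hnp L hL.le] with X hX
  obtain ⟨l, hl, hlv⟩ := exists_mem_map_eq hn _ (sum_columnCombination_standardizedVector X) L hL
    hX v
  refine Or.inr (Or.inr ⟨v - l, Submodule.sub_mem _ hv (hLs hl), ?_, ?_⟩)
  · rw [map_sub, hlv, sub_self]
  · have hgl : signFunctional D s l = 0 := hLg hl
    rwa [map_sub, hgl, sub_zero]

/-! ### Return to the matrix form and conclusion -/

theorem centeringMatrix_mul_of_apply {n p : ℕ} (X : Fin n → Fin p → ℝ) (i : Fin n) (j : Fin p) :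
    (centeringMatrix n * Matrix.of X) i j = (centeringMatrix n *ᵥ fun k => X k j) i := rfl

theorem isUnit_columnNormMatrix {n p : ℕ} {X : Fin n → Fin p → ℝ}
    (hX : ∀ j, centeringMatrix n *ᵥ (fun i => X i j) ≠ 0) :
    IsUnit (columnNormMatrix (centeringMatrix n * Matrix.of X)) := by
  rw [columnNormMatrix, isUnit_diagonal, Pi.isUnit_iff]
  intro j
  rw [isUnit_iff_ne_zero, norm_ne_zero_iff]
  intro h
  exact hX j ((WithLp.toLp_eq_zero 2).1 h)

theorem standardizedMatrix_mulVec {n p : ℕ} {X : Fin n → Fin p → ℝ}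
    (hX : ∀ j, centeringMatrix n *ᵥ (fun i => X i j) ≠ 0) (v : Fin p → ℝ) :
    standardizedMatrix (Matrix.of X) *ᵥ v = columnCombination standardizedVector X v := by
  have hinv : (columnNormMatrix (centeringMatrix n * Matrix.of X))⁻¹ =
      diagonal fun j => ‖WithLp.toLp 2 (centeringMatrix n *ᵥ fun i => X i j)‖⁻¹ := by
    refine inv_eq_left_inv ?_
    rw [columnNormMatrix, diagonal_mul_diagonal, ← diagonal_one]
    congr 1
    ext j
    exact inv_mul_cancel₀ (by simpa using hX j)
  ext i
  rw [standardizedMatrix, hinv, columnCombination_apply, Finset.sum_apply, mulVec, dotProduct]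
  refine Finset.sum_congr rfl fun j _ => ?_
  rw [mul_diagonal, centeringMatrix_mul_of_apply]
  simp only [standardizedVector, Pi.smul_apply, smul_eq_mul]
  ring

/-- The conclusion holds for Lebesgue-almost every `X` and every `y`. -/
theorem ae_existsUnique_isGenLassoSolution {n p m : ℕ} (D : Matrix (Fin m) (Fin p) ℝ) {lam : ℝ}
    (hlam : 0 < lam) (hdim : p + 1 ≤ n ∨ (3 ≤ n ∧ matrixNullity D + 1 ≤ n)) :
    ∀ᵐ X : Fin n → Fin p → ℝ,
      IsUnit (columnNormMatrix (centeringMatrix n * Matrix.of X)) ∧ ∀ y : Fin n → ℝ,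
        ∃! β : Fin p → ℝ, IsGenLassoSolution y (standardizedMatrix (Matrix.of X)) D lam β := by
  have hn : 1 ≤ n := by omega
  have hnp : p + 1 ≤ n ∨ 3 ≤ n := hdim.imp_right And.left
  have hnull : Module.finrank ℝ (LinearMap.ker D.mulVecLin) + 1 ≤ n := by
    rcases hdim with h | h
    · have := Submodule.finrank_le (LinearMap.ker D.mulVecLin)
      rw [Module.finrank_fin_fun] at this
      omega
    · exact h.2
  have hcol : ∀ᵐ X : Fin n → Fin p → ℝ, ∀ j, centeringMatrix n *ᵥ (fun i => X i j) ≠ 0 :=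
    -- A column index forces `p ≥ 1`, hence `n ≥ 2` in either case.
    ae_all_iff.2 fun j => ae_centeringMatrix_mulVec_column_ne_zero (by have := j.2; omega) j
  filter_upwards [hcol, ae_injective_columnCombination_standardizedVector hnp _ hnull,
    ae_all_iff.2 (ae_sign_condition hn hnp D)] with X hX hker hsign
  refine ⟨isUnit_columnNormMatrix hX, fun y => ?_⟩
  refine existsUnique_isGenLassoSolution y _ D hlam (fun v hDv hv => hker v hDv ?_) fun s => ?_
  · rwa [← standardizedMatrix_mulVec hX]
  · simpa only [standardizedMatrix_mulVec hX] using hsign s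

end

theorem mainTheorem10 {n p m : ℕ} (D : Matrix (Fin m) (Fin p) ℝ) (lam : ℝ) (hlam : 0 < lam)
    {Ω : Type*} [MeasurableSpace Ω] (μ : Measure Ω) [IsProbabilityMeasure μ]
    (X : Ω → Fin n → Fin p → ℝ) (y : Ω → Fin n → ℝ)
    (hmeas : AEMeasurable (fun ω => (X ω, y ω)) μ)
    (hac : μ.map (fun ω => (X ω, y ω)) ≪
      (volume : Measure ((Fin n → Fin p → ℝ) × (Fin n → ℝ))))
    (hdim : p + 1 ≤ n ∨ (3 ≤ n ∧ matrixNullity D + 1 ≤ n)) :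
    ∀ᵐ ω ∂μ,
      IsUnit (columnNormMatrix (centeringMatrix n * Matrix.of (X ω))) ∧
      ∃! β : Fin p → ℝ,
        IsGenLassoSolution (y ω) (standardizedMatrix (Matrix.of (X ω))) D lam β := by
  have h := Measure.quasiMeasurePreserving_fst
    (μ := (volume : Measure (Fin n → Fin p → ℝ))) (ν := (volume : Measure (Fin n → ℝ))) |>.ae
      (ae_existsUnique_isGenLassoSolution D hlam hdim)
  filter_upwards [ae_of_ae_map hmeas (hac.ae_le h)] with ω hω
  exact ⟨hω.1, hω.2 (y ω)⟩
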